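/- Let $a,n\ge 1$ be integers, $\mu\in\mathbb R$, $\sigma^2>0$ and $\sigma_\alpha^2\ge 0$. Consider the one-way random effects model \[ y_{ij}=\mu+\alpha_i+e_{ij},\qquad i=1,\dots,a,\ j=1,\dots,n, \] where $\alpha_i\sim N(0,\sigma_\alpha^2)$, $e_{ij}\sim N(0,\sigma^2)$, and all the random variables $\alpha_i$ and $e_{ij}$ are mutually independent. Let $\bar y_{i.}=\frac1n\sum_j y_{ij}$, $\bar y_{..}=\frac1{an}\sum_{i,j}y_{ij}$, and \[ SS_A=\sum_{i=1}^a\sum_{j=1}^n(\bar y_{i.}-\bar y_{..})^2,\qquad SS_E=\sum_{i=1}^a\sum_{j=1}^n(y_{ij}-\bar y_{i.})^2 . \] Write $\chi^2(k)$ for the law of the sum of squares of $k$ independent standard normal variables (the point mass at $0$ if $k=0$), $F(d_1,d_2)$ for the law of $(U/d_1)/(V/d_2)$ with $U\sim\chi^2(d_1)$ and $V\sim\chi^2(d_2)$ independent, and $c\,\nu$ for the law of $cX$ when $X\sim\nu$. Then $SS_A$ and $SS_E$ are independent, and \[ SS_A\sim(\sigma^2+n\sigma_\alpha^2)\,\chi^2(a-1),\qquad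 SS_E\sim\sigma^2\,\chi^2(a(n-1)). \] If moreover $a\ge2$ and $n\ge2$, then with $MS_A=SS_A/(a-1)$ and $MS_E=SS_E/[a(n-1)]$, \[ F_A=\frac{MS_A}{MS_E}\sim\frac{\sigma^2+n\sigma_\alpha^2}{\sigma^2}\,F(a-1,a(n-1)). \] -/

import Mathlib

open MeasureTheory ProbabilityTheory
open scoped NNReal

namespace OneWayAnova

/-- The (central) chi-square distribution with `k` degrees of freedom: the law of
`Z₁² + ⋯ + Z_k²` for independent standard normal `Z₁, …, Z_k`. For `k = 0` this is the
point mass at `0`. -/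
noncomputable def chiSquare (k : ℕ) : Measure ℝ :=
  (Measure.pi (fun _ : Fin k => gaussianReal 0 1)).map (fun z => ∑ i, z i ^ 2)

/-- The (central) `F` distribution with `d₁` and `d₂` degrees of freedom: the law of
`(U / d₁) / (V / d₂)` for independent `U ~ χ²(d₁)` and `V ~ χ²(d₂)`.
Meaningful for `d₁, d₂ ≥ 1`. -/
noncomputable def fDist (d₁ d₂ : ℕ) : Measure ℝ :=
  ((chiSquare d₁).prod (chiSquare d₂)).map (fun p => (p.1 / d₁) / (p.2 / d₂))

/-- The law of `c * X` when `X` has law `ν`. -/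
noncomputable def scaled (c : ℝ) (ν : Measure ℝ) : Measure ℝ :=
  ν.map (fun x => c * x)

variable {a n : ℕ}

/-- The group mean `ȳ_{i.}`. -/
noncomputable def groupMean (y : Fin a → Fin n → ℝ) (i : Fin a) : ℝ :=
  (∑ j, y i j) / n

/-- The overall mean `ȳ_{..}`. -/
noncomputable def grandMean (y : Fin a → Fin n → ℝ) : ℝ :=
  (∑ i, ∑ j, y i j) / ((a : ℝ) * n)

/-- The sum of squares due to factor `A`. -/
noncomputable def SSA (y : Fin a → Fin n → ℝ) : ℝ :=
  ∑ i : Fin a, ∑ _j : Fin n, (groupMean y i - grandMean y) ^ 2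

/-- The error sum of squares. -/
noncomputable def SSE (y : Fin a → Fin n → ℝ) : ℝ :=
  ∑ i : Fin a, ∑ j : Fin n, (y i j - groupMean y i) ^ 2

/-- The mean sum of squares due to factor `A`. -/
noncomputable def MSA (y : Fin a → Fin n → ℝ) : ℝ :=
  SSA y / ((a : ℝ) - 1)

/-- The error mean sum of squares. -/
noncomputable def MSE (y : Fin a → Fin n → ℝ) : ℝ :=
  SSE y / ((a : ℝ) * ((n : ℝ) - 1))

/-- The test statistic `F_A`. -/
noncomputable def FA (y : Fin a → Fin n → ℝ) : ℝ :=
  MSA y / MSE y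

/-- The one-way random effects model `y i j = μ + α i + e i j`, with `α i ~ N(0, σαsq)`,
`e i j ~ N(0, σsq)` and all the `α i` and `e i j` mutually independent. -/
structure RandomEffectsModel {Ω : Type*} [MeasurableSpace Ω] (P : Measure Ω)
    (μ : ℝ) (σsq σαsq : ℝ≥0) (α : Fin a → Ω → ℝ) (e y : Fin a → Fin n → Ω → ℝ) : Prop where
  effect_law : ∀ i, HasLaw (α i) (gaussianReal 0 σαsq) P
  error_law : ∀ i j, HasLaw (e i j) (gaussianReal 0 σsq) P
  indep : iIndepFun (Sum.elim α (fun p : Fin a × Fin n => e p.1 p.2)) P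
  response : ∀ i j ω, y i j ω = μ + α i ω + e i j ω

end OneWayAnova

open OneWayAnova

namespace OneWayAnova

/-! Both sums of squares are sums of squares of orthogonal contrasts. With Helmert matrices `H` and
`K` from `exists_helmert`, `SSA` is built from √n ∑ᵢ H l i ȳᵢ. and `SSE` from ∑ⱼ K k j yᵢⱼ. Zero row
sums remove μ from the former and μ + αᵢ from the latter, leaving (a-1) + a(n-1) linear forms in the
independent Gaussians αᵢ, eᵢⱼ. By `sum_contrast_mul` these are pairwise uncorrelated, with variances
σ² + nσ_α² and σ²; being jointly Gaussian, they are independent (`iIndepFun_linearForms`). The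
chi-square laws and the independence follow, and `hasLaw_ratio` gives the F law. -/

/-- Existence of a Helmert matrix: the rows form an orthonormal basis of the orthogonal complement
of the constant vectors, so its squared norm computes the sum of squared deviations. -/
lemma exists_helmert (m : ℕ) : ∃ H : Fin m → Fin (m + 1) → ℝ,
    (∀ k, ∑ j, H k j = 0) ∧
    (∀ k l, ∑ j, H k j * H l j = if k = l then 1 else 0) ∧
    ∀ x : Fin (m + 1) → ℝ,
      ∑ k, (∑ j, H k j * x j) ^ 2 = ∑ j, (x j - (∑ i, x i) / (m + 1 : ℕ)) ^ 2 := by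
  have hpos : (0 : ℝ) < (m + 1 : ℕ) := by positivity
  set c : ℝ := (√(m + 1 : ℕ))⁻¹ with hc
  have hc2 : c ^ 2 = ((m + 1 : ℕ) : ℝ)⁻¹ := by
    rw [hc, inv_pow, Real.sq_sqrt hpos.le]
  have hc0 : c ≠ 0 := by rw [hc]; positivity
  let u : EuclideanSpace ℝ (Fin (m + 1)) := WithLp.toLp 2 fun _ => c
  have hu : ‖u‖ = 1 := by
    have h : ‖u‖ ^ 2 = 1 := by
      rw [EuclideanSpace.real_norm_sq_eq]
      simp only [u, Finset.sum_const, Finset.card_univ, Fintype.card_fin, nsmul_eq_mul, hc2]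
      exact mul_inv_cancel₀ hpos.ne'
    exact (pow_eq_one_iff_of_nonneg (norm_nonneg u) two_ne_zero).1 h
  -- The unit constant vector becomes basis vector 0; the other basis vectors are the rows of `H`.
  obtain ⟨b, hb⟩ := Orthonormal.exists_orthonormalBasis_extension_of_card_eq (𝕜 := ℝ)
    (E := EuclideanSpace ℝ (Fin (m + 1))) (ι := Fin (m + 1)) (by simp)
    (v := fun _ => u) (s := {0}) ⟨fun _ => hu, fun i j hij => (hij (Subsingleton.elim i j)).elim⟩
  have hb0 : ∀ j, b 0 j = c := fun j => by rw [hb 0 rfl]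
  have hinner : ∀ k l, ∑ j, b k j * b l j = if k = l then 1 else 0 := fun k l => by
    rw [← orthonormal_iff_ite.1 b.orthonormal k l]
    simp [PiLp.inner_apply, mul_comm]
  refine ⟨fun k j => b k.succ j, fun k => ?_, fun k l => ?_, fun x => ?_⟩
  · have h := hinner k.succ 0
    simp only [hb0, ← Finset.sum_mul, Fin.succ_ne_zero, if_false] at h
    exact (mul_eq_zero.1 h).resolve_right hc0
  · simp [hinner, Fin.succ_inj]
  -- Parseval: removing the component along `b 0`, whose square is (∑ xᵢ)²/(m + 1), leaves the
  -- squared deviations.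
  · have h := b.sum_sq_inner_right (WithLp.toLp 2 x)
    rw [EuclideanSpace.real_norm_sq_eq, Fin.sum_univ_succ] at h
    simp only [PiLp.inner_apply, hb0, RCLike.inner_apply, conj_trivial, ← Finset.sum_mul] at h
    rw [mul_pow, hc2] at h
    simp only [mul_comm (b _ _)]
    rw [eq_sub_of_add_eq' h]
    simp only [sub_sq, Finset.sum_add_distrib, Finset.sum_sub_distrib, ← Finset.sum_mul,
      ← Finset.mul_sum, Finset.sum_const, Finset.card_univ, Fintype.card_fin, nsmul_eq_mul]
    field_simp
    ring

section Gaussian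

variable {Ω ι κ : Type*} [MeasurableSpace Ω] {P : Measure Ω} [Fintype ι] [Fintype κ]

/-- Linear forms in independent centred Gaussian variables that are pairwise uncorrelated are
independent centred Gaussian variables. -/
lemma iIndepFun_linearForms {X : ι → Ω → ℝ} {v : ι → ℝ≥0} (hX : iIndepFun X P)
    (hlaw : ∀ i, HasLaw (X i) (gaussianReal 0 (v i)) P) (c : κ → ι → ℝ) (s : κ → ℝ≥0)
    (horth : ∀ k l, k ≠ l → ∑ i, c k i * c l i * v i = 0)
    (hnorm : ∀ k, ∑ i, c k i * c k i * v i = s k) :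
    iIndepFun (fun k ω => ∑ i, c k i * X i ω) P ∧
      ∀ k, HasLaw (fun ω => ∑ i, c k i * X i ω) (gaussianReal 0 (s k)) P := by
  classical
  have := hX.isProbabilityMeasure
  have hG : ∀ i, HasGaussianLaw (X i) P := fun i => (hlaw i).hasGaussianLaw
  have hjoint := hX.hasGaussianLaw hG
  let T : (ι → ℝ) →L[ℝ] (κ → ℝ) :=
    ContinuousLinearMap.pi fun k => ∑ i, c k i • ContinuousLinearMap.proj i
  have hT : HasGaussianLaw (fun ω k => ∑ i, c k i * X i ω) P := by
    convert! hjoint.map_fun T using 3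
    simp [T]
  have hcovX : ∀ i j, cov[X i, X j; P] = if i = j then (v i : ℝ) else 0 := fun i j => by
    split_ifs with h
    · subst h
      rw [covariance_self (hG i).aemeasurable, (hlaw i).variance_eq, variance_id_gaussianReal]
    · exact (hX.indepFun h).covariance_eq_zero (hG i).memLp_two (hG j).memLp_two
  have hcov : ∀ k l, cov[fun ω => ∑ i, c k i * X i ω, fun ω => ∑ i, c l i * X i ω; P]
      = ∑ i, c k i * c l i * v i := fun k l => by
    rw [covariance_fun_sum_fun_sum (fun i => (hG i).memLp_two.const_mul _)
      (fun i => (hG i).memLp_two.const_mul _)]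
    simp [covariance_const_mul_left, covariance_const_mul_right, hcovX, mul_assoc, mul_left_comm]
  refine ⟨hT.iIndepFun_of_covariance_eq_zero fun k l hkl => by rw [hcov, horth k l hkl],
    fun k => ?_⟩
  have hk : HasGaussianLaw (fun ω => ∑ i, c k i * X i ω) P := hT.eval k
  refine ⟨hk.aemeasurable, ?_⟩
  have hmean : ∫ ω, ∑ i, c k i * X i ω ∂P = 0 := by
    rw [integral_finsetSum _ fun i _ => (hG i).integrable.const_mul _]
    simp [integral_const_mul, (hlaw _).integral_eq]
  rw [hk.map_eq_gaussianReal, hmean, ← covariance_self hk.aemeasurable, hcov, hnorm,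
    Real.toNNReal_coe]

/-- The sum of squares of independent `N(0, s)` variables has a scaled chi-square law. -/
lemma hasLaw_sum_sq {W : κ → Ω → ℝ} {s : ℝ≥0} {d : ℕ} (hd : Fintype.card κ = d)
    (hW : iIndepFun W P) (hlaw : ∀ k, HasLaw (W k) (gaussianReal 0 s) P) :
    HasLaw (fun ω => ∑ k, W k ω ^ 2) (scaled s (chiSquare d)) P := by
  have := hW.isProbabilityMeasure
  let f : κ ≃ Fin d := Fintype.equivFinOfCardEq hd
  have hpi : HasLaw (fun ω i => W (f.symm i) ω)
      (Measure.pi fun _ : Fin d => gaussianReal 0 s) P :=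
    (hW.precomp f.symm.injective).hasLaw_pi fun i => hlaw (f.symm i)
  -- Writing N(0, s) as √s · N(0, 1) also covers the degenerate case s = 0.
  have hscale : (Measure.pi fun _ : Fin d => gaussianReal 0 1).map (fun z i => √s * z i)
      = Measure.pi fun _ : Fin d => gaussianReal 0 s := by
    have h1 : (gaussianReal 0 1).map (fun x => √s * x) = gaussianReal 0 s := by
      rw [gaussianReal_map_const_mul]
      congr 1
      · simp
      · ext; simp
    have : ∀ _ : Fin d, SigmaFinite ((gaussianReal 0 1).map (fun x => √s * x)) := fun _ => by
      rw [h1]; infer_instance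
    rw [Measure.pi_map_pi (fun _ => by fun_prop)]
    simp_rw [h1]
  have hsq : HasLaw (fun z : Fin d → ℝ => ∑ i, z i ^ 2) (scaled s (chiSquare d))
      (Measure.pi fun _ : Fin d => gaussianReal 0 s) := by
    have hm : Measurable fun z : Fin d → ℝ => ∑ i, z i ^ 2 := by fun_prop
    refine ⟨hm.aemeasurable, ?_⟩
    rw [← hscale, scaled, chiSquare, Measure.map_map (by fun_prop) (by fun_prop),
      Measure.map_map (by fun_prop) (by fun_prop)]
    congr 1
    ext z
    simp [mul_pow, Finset.mul_sum]
  refine (hsq.fun_comp hpi).congr (.of_forall fun ω => ?_)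
  exact (Equiv.sum_comp f.symm fun k => W k ω ^ 2).symm

end Gaussian

/-- The law of the ratio of two independent scaled chi-square variables, each divided by its
degrees of freedom. -/
lemma hasLaw_ratio {Ω : Type*} [MeasurableSpace Ω] {P : Measure Ω} [IsProbabilityMeasure P]
    {U V : Ω → ℝ} {c s : ℝ} {d₁ d₂ : ℕ} (hUV : IndepFun U V P)
    (hU : HasLaw U (scaled c (chiSquare d₁)) P) (hV : HasLaw V (scaled s (chiSquare d₂)) P) :
    HasLaw (fun ω => (U ω / d₁) / (V ω / d₂)) (scaled (c / s) (fDist d₁ d₂)) P := by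
  have hχ : ∀ d, IsProbabilityMeasure (chiSquare d) := fun d =>
    Measure.isProbabilityMeasure_map (Measurable.aemeasurable (by fun_prop))
  have hpair : P.map (fun ω => (U ω, V ω))
      = (scaled c (chiSquare d₁)).prod (scaled s (chiSquare d₂)) := by
    rw [(indepFun_iff_map_prod_eq_prod_map_map hU.aemeasurable hV.aemeasurable).1 hUV,
      hU.map_eq, hV.map_eq]
  have hg : Measurable fun p : ℝ × ℝ => (p.1 / d₁) / (p.2 / d₂) := by fun_prop
  have hm := hU.aemeasurable.prodMk hV.aemeasurable
  refine ⟨hg.comp_aemeasurable hm, ?_⟩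
  have hcomp := AEMeasurable.map_map_of_aemeasurable hg.aemeasurable hm
  rw [Function.comp_def] at hcomp
  rw [← hcomp, hpair, scaled, scaled, Measure.map_prod_map _ _ (by fun_prop) (by fun_prop),
    scaled, fDist, Measure.map_map hg (by fun_prop), Measure.map_map (by fun_prop) hg]
  congr 1
  ext p
  simp only [Function.comp_apply, Prod.map_fst, Prod.map_snd]
  -- Since 0⁻¹ = 0, the identity needs no nonvanishing denominators.
  ring

/-- The coefficients, in terms of the random effects and the errors, of the contrasts whose squares
sum to `SSA` (left) and `SSE` (right). -/
noncomputable def contrast {p q : ℕ} (H : Fin p → Fin (p + 1) → ℝ) (K : Fin q → Fin (q + 1) → ℝ) :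
    Fin p ⊕ (Fin (p + 1) × Fin q) → Fin (p + 1) ⊕ (Fin (p + 1) × Fin (q + 1)) → ℝ
  | .inl l, .inl i => √(q + 1 : ℕ) * H l i
  | .inl l, .inr r => (√(q + 1 : ℕ))⁻¹ * H l r.1
  | .inr _, .inl _ => 0
  | .inr t, .inr r => if t.1 = r.1 then K t.2 r.2 else 0

/-- This is the covariance matrix of the contrasts, `x` and `y` being the variances of effects and
errors. Mixed entries vanish because the rows of `K` sum to zero. -/
lemma sum_contrast_mul {p q : ℕ} {H : Fin p → Fin (p + 1) → ℝ} {K : Fin q → Fin (q + 1) → ℝ}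
    (hH : ∀ k l, ∑ j, H k j * H l j = if k = l then 1 else 0)
    (hK0 : ∀ k, ∑ j, K k j = 0)
    (hK : ∀ k l, ∑ j, K k j * K l j = if k = l then 1 else 0) (x y : ℝ≥0)
    (k l : Fin p ⊕ (Fin (p + 1) × Fin q)) :
    ∑ i, contrast H K k i * contrast H K l i
        * ((Sum.elim (fun _ => x) (fun _ => y) i : ℝ≥0) : ℝ)
      = if k = l then
          ((Sum.elim (fun _ => y + (q + 1 : ℕ) * x) (fun _ => y) k : ℝ≥0) : ℝ) else 0 := by
  have hpos : (0 : ℝ) < (q + 1 : ℕ) := by positivity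
  have hs : √(q + 1 : ℕ) * √(q + 1 : ℕ) = ((q + 1 : ℕ) : ℝ) := Real.mul_self_sqrt hpos.le
  rcases k with k | ⟨k, k'⟩ <;> rcases l with l | ⟨l, l'⟩
  · have h1 : ∀ i, √(q + 1 : ℕ) * H k i * (√(q + 1 : ℕ) * H l i) * (x : ℝ)
        = ((q + 1 : ℕ) * x) * (H k i * H l i) := fun i => by
      linear_combination (H k i * H l i * x) * hs
    have h2 : ∀ i, (√(q + 1 : ℕ))⁻¹ * H k i * ((√(q + 1 : ℕ))⁻¹ * H l i) * (y : ℝ)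
        = ((q + 1 : ℕ) : ℝ)⁻¹ * y * (H k i * H l i) := fun i => by
      have h := congrArg Inv.inv hs
      rw [mul_inv] at h
      linear_combination (H k i * H l i * y) * h
    simp only [Fintype.sum_sum_type, Fintype.sum_prod_type, contrast, Sum.elim_inl, Sum.elim_inr,
      h1, h2, Finset.sum_const, Finset.card_univ, Fintype.card_fin, nsmul_eq_mul,
      ← Finset.mul_sum, hH, Sum.inl.injEq]
    split_ifs
    · push_cast at hpos ⊢
      field_simp
      ring
    · simp
  · have h : ∑ j, (√(q + 1 : ℕ))⁻¹ * H k l * K l' j * (y : ℝ) = 0 := by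
      rw [← Finset.sum_mul, ← Finset.mul_sum, hK0]; ring
    simp [Fintype.sum_sum_type, Fintype.sum_prod_type, contrast]
    simpa using h
  · have h : ∑ j, K k' j * ((√(q + 1 : ℕ))⁻¹ * H l k) * (y : ℝ) = 0 := by
      rw [← Finset.sum_mul, ← Finset.sum_mul, hK0]; ring
    simp [Fintype.sum_sum_type, Fintype.sum_prod_type, contrast]
    simpa using h
  · by_cases hkl : k = l
    · subst hkl
      simp [Fintype.sum_sum_type, Fintype.sum_prod_type, contrast, ← Finset.sum_mul, hK]
    · simp [Fintype.sum_sum_type, Fintype.sum_prod_type, contrast, hkl]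

end OneWayAnova

theorem mainTheorem2 {Ω : Type*} [MeasurableSpace Ω] (P : Measure Ω) [IsProbabilityMeasure P]
    (a n : ℕ) (ha : 1 ≤ a) (hn : 1 ≤ n) (μ : ℝ) (σsq σαsq : ℝ≥0) (hσ : 0 < σsq)
    (α : Fin a → Ω → ℝ) (e y : Fin a → Fin n → Ω → ℝ)
    (hmodel : RandomEffectsModel P μ σsq σαsq α e y) :
    IndepFun (fun ω => SSA (fun i j => y i j ω)) (fun ω => SSE (fun i j => y i j ω)) P ∧
    HasLaw (fun ω => SSA (fun i j => y i j ω))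
      (scaled ((σsq : ℝ) + n * σαsq) (chiSquare (a - 1))) P ∧
    HasLaw (fun ω => SSE (fun i j => y i j ω))
      (scaled (σsq : ℝ) (chiSquare (a * (n - 1)))) P ∧
    (2 ≤ a → 2 ≤ n →
      HasLaw (fun ω => FA (fun i j => y i j ω))
        (scaled (((σsq : ℝ) + n * σαsq) / σsq) (fDist (a - 1) (a * (n - 1)))) P) := by
  obtain ⟨p, rfl⟩ : ∃ p, a = p + 1 := ⟨a - 1, by omega⟩
  obtain ⟨q, rfl⟩ : ∃ q, n = q + 1 := ⟨n - 1, by omega⟩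
  obtain ⟨H, hH0, hH, hHsq⟩ := exists_helmert p
  obtain ⟨K, hK0, hK, hKsq⟩ := exists_helmert q
  simp only [Nat.add_sub_cancel]
  set X := Sum.elim α (fun r : Fin (p + 1) × Fin (q + 1) => e r.1 r.2) with hX
  set W : Fin p ⊕ (Fin (p + 1) × Fin q) → Ω → ℝ := fun k ω => ∑ i, contrast H K k i * X i ω with hW
  obtain ⟨hind, hlaw⟩ := iIndepFun_linearForms hmodel.indep
    (v := Sum.elim (fun _ => σαsq) (fun _ => σsq))
    (by rintro (i | r); exacts [hmodel.effect_law i, hmodel.error_law r.1 r.2])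
    (contrast H K) (Sum.elim (fun _ => σsq + (q + 1 : ℕ) * σαsq) (fun _ => σsq))
    (fun k l hkl => by rw [sum_contrast_mul hH hK0 hK, if_neg hkl])
    (fun k => by rw [sum_contrast_mul hH hK0 hK, if_pos rfl])
  have hpos : (0 : ℝ) < (q + 1 : ℕ) := by positivity
  have hSSA : ∀ ω, SSA (fun i j => y i j ω) = ∑ l, W (.inl l) ω ^ 2 := fun ω => by
    have hgm : grandMean (fun i j => y i j ω)
        = (∑ i, groupMean (fun i j => y i j ω) i) / (p + 1 : ℕ) := by
      simp only [grandMean, groupMean, ← Finset.sum_div]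
      rw [div_div, mul_comm ((q + 1 : ℕ) : ℝ)]
    simp only [SSA, hgm, Finset.sum_const, Finset.card_univ, Fintype.card_fin, nsmul_eq_mul,
      ← Finset.mul_sum, ← hHsq]
    rw [Finset.mul_sum]
    refine Finset.sum_congr rfl fun l _ => ?_
    -- The factor n from the inner sum over j is absorbed into each square as √n.
    rw [← Real.sq_sqrt hpos.le, ← mul_pow]
    congr 1
    have hgroup : ∀ i, groupMean (fun i j => y i j ω) i
        = μ + α i ω + ((q + 1 : ℕ) : ℝ)⁻¹ * ∑ j, e i j ω := fun i => by
      simp only [groupMean, hmodel.response, Finset.sum_add_distrib, Finset.sum_const,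
        Finset.card_univ, Fintype.card_fin, nsmul_eq_mul]
      field_simp
    have hinv : √(q + 1 : ℕ) * ((q + 1 : ℕ) : ℝ)⁻¹ = (√(q + 1 : ℕ))⁻¹ := by
      rw [← div_eq_mul_inv, Real.sqrt_div_self', one_div]
    simp only [hgroup, mul_add, Finset.sum_add_distrib, ← Finset.sum_mul, hH0, zero_mul, zero_add,
      hW, hX, Fintype.sum_sum_type, Fintype.sum_prod_type, contrast, Sum.elim_inl, Sum.elim_inr]
    congr 1
    · simp only [Finset.mul_sum, mul_assoc]
    · simp only [← hinv, Finset.mul_sum]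
      exact Finset.sum_congr rfl fun i _ => Finset.sum_congr rfl fun j _ => by ring
  have hSSE : ∀ ω, SSE (fun i j => y i j ω) = ∑ r, W (.inr r) ω ^ 2 := fun ω => by
    rw [Fintype.sum_prod_type]
    refine Finset.sum_congr rfl fun i _ => ?_
    simp only [groupMean]
    rw [← hKsq]
    refine Finset.sum_congr rfl fun k _ => ?_
    congr 1
    simp only [hmodel.response, mul_add, Finset.sum_add_distrib, ← Finset.sum_mul, hK0, zero_mul,
      zero_add]
    simp [hW, hX, Fintype.sum_sum_type, Fintype.sum_prod_type, contrast, ite_mul]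
  have hA : HasLaw (fun ω => SSA (fun i j => y i j ω))
      (scaled ((σsq : ℝ) + (q + 1 : ℕ) * σαsq) (chiSquare p)) P := by
    have h := hasLaw_sum_sq (Fintype.card_fin p) (hind.precomp Sum.inl_injective)
      fun l => hlaw (.inl l)
    simpa using! HasLaw.congr h (.of_forall hSSA)
  have hE : HasLaw (fun ω => SSE (fun i j => y i j ω))
      (scaled (σsq : ℝ) (chiSquare ((p + 1) * q))) P :=
    (hasLaw_sum_sq (by simp) (hind.precomp Sum.inr_injective)
      fun r => hlaw (.inr r)).congr (.of_forall hSSE)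
  have hAE : IndepFun (fun ω => SSA (fun i j => y i j ω)) (fun ω => SSE (fun i j => y i j ω)) P := by
    simp only [hSSA, hSSE]
    -- The two statistics are functions of disjoint blocks of an independent family.
    have h := hind.indepFun_finset₀ (Finset.univ.map .inl) (Finset.univ.map .inr)
      (by simp [Finset.disjoint_left]) fun k => (hlaw k).aemeasurable
    have hl : Measurable fun z : (Finset.univ.map (.inl : Fin p ↪ Fin p ⊕ (Fin (p + 1) × Fin q)))
        → ℝ => ∑ l, z ⟨.inl l, by simp⟩ ^ 2 := by fun_prop
    have hr : Measurable fun z : (Finset.univ.map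
        (.inr : (Fin (p + 1) × Fin q) ↪ Fin p ⊕ (Fin (p + 1) × Fin q))) → ℝ =>
        ∑ r, z ⟨.inr r, by simp⟩ ^ 2 := by fun_prop
    exact h.comp hl hr
  refine ⟨hAE, hA, hE, fun _ _ => ?_⟩
  refine (hasLaw_ratio hAE hA hE).congr (.of_forall fun ω => ?_)
  simp [FA, MSA, MSE]
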